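/- Let $F$ be a field, $n\ge 1$, let $G$ be a connected simple graph on the vertex set $[n]=\{1,\dots,n\}$, and let $S=F[x_1,\dots,x_n,y_1,\dots,y_n]$. The binomial edge ideal of $G$ is $J_G=\langle x_iy_j-x_jy_i : \{i,j\}\in E(G)\rangle\subseteq S$. For $i,j\in[n]$, an $(i,j)$-path in $G$ is a sequence of vertices $i=i_0,i_1,\dots,i_r=j$ ($r\ge 0$) with $\{i_k,i_{k+1}\}\in E(G)$ for all $0\le k<r$. It is called weakly admissible if its vertices are pairwise distinct and there is no $(i,j)$-path $(j_0,\dots,j_s)$ in $G$ with $\{j_0,\dots,j_s\}\subsetneq\{i_0,\dots,i_r\}$. Consider the following three subsets of $S$. * $\mathcal S(J_G)$ is the set of all nonzero binomials $t_{i_1}t_{i_2}\cdots t_{i_{r-1}}(x_iy_j-x_jy_i)$, where $i,j\in[n]$, $(i_0,\dots,i_r)$ is a weakly admissible $(i,j)$-path in $G$ and $t_k\in\{x_k,y_k\}$ for each $k$. * $\mathcal U(J_G)$ is the universal Gröbner basis of $J_G$, that is, the union of the reduced Gröbner bases of $J_G$ with respect to all monomial orders on $S$. * $\mathrm{Gr}(J_G)$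 is the Graver basis of $J_G$, that is, the set of primitive binomials of $J_G$. Here a nonzero binomial $\mathbf x^{u}-\mathbf x^{v}\in J_G$ (a difference of two distinct monic monomials of $S$) is primitive if there is no other nonzero binomial $\mathbf x^{u'}-\mathbf x^{v'}\in J_G$ such that $\mathbf x^{u'}$ divides $\mathbf x^{u}$ and $\mathbf x^{v'}$ divides $\mathbf x^{v}$. Then $\mathcal S(J_G)=\mathcal U(J_G)=\mathrm{Gr}(J_G)$. -/

import Mathlib

open MvPolynomial

noncomputable section

namespace BEI

universe u v

section Groebner

variable {σ : Type u} {F : Type v} [Field F]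

/-- `B` is a Gröbner basis of `I` with respect to `m`: a finite subset of `I` whose leading terms
generate the ideal generated by the leading terms of all elements of `I`. -/
def IsGroebnerBasis (m : MonomialOrder.{u, u} σ) (I : Ideal (MvPolynomial σ F))
    (B : Set (MvPolynomial σ F)) : Prop :=
  B.Finite ∧ B ⊆ (I : Set (MvPolynomial σ F)) ∧
    Ideal.span (m.leadingTerm '' B) = Ideal.span (m.leadingTerm '' (I : Set (MvPolynomial σ F)))

/-- A Gröbner basis is reduced if its elements are monic and no monomial occurring in an element
`b` is divisible by the leading monomial of another element. -/
def IsReducedGroebnerBasis (m : MonomialOrder.{u, u} σ) (I : Ideal (MvPolynomial σ F))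
    (B : Set (MvPolynomial σ F)) : Prop :=
  IsGroebnerBasis m I B ∧ (∀ b ∈ B, m.Monic b) ∧
    ∀ b ∈ B, ∀ d ∈ b.support, ∀ b' ∈ B, b' ≠ b → ¬ m.degree b' ≤ d

/-- The universal Gröbner basis: the union of all reduced Gröbner bases, over all monomial orders.
(Every monomial order can be carried by the type `σ →₀ ℕ` itself, so the universe chosen here
does not restrict the orders.) -/
def universalGroebnerBasis (I : Ideal (MvPolynomial σ F)) : Set (MvPolynomial σ F) :=
  {f | ∃ (m : MonomialOrder.{u, u} σ) (B : Set (MvPolynomial σ F)),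
    IsReducedGroebnerBasis m I B ∧ f ∈ B}

/-- The pure difference binomial with exponent vectors `a` and `b`. -/
def binomial (F : Type v) [Field F] (a b : σ →₀ ℕ) : MvPolynomial σ F :=
  monomial a 1 - monomial b 1

/-- The (nonzero) binomial with exponents `a ≠ b` lies in `I`, and there is no other nonzero
binomial in `I`, with exponents `a'`, `b'`, such that the first monomial divides the first one and
the second the second one. -/
def IsPrimitive (I : Ideal (MvPolynomial σ F)) (a b : σ →₀ ℕ) : Prop :=
  a ≠ b ∧ binomial F a b ∈ I ∧
    ∀ a' b' : σ →₀ ℕ, a' ≠ b' → binomial F a' b' ∈ I → a' ≤ a → b' ≤ b → a' = a ∧ b' = b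

/-- The Graver basis: the set of primitive binomials. -/
def graverBasis (I : Ideal (MvPolynomial σ F)) : Set (MvPolynomial σ F) :=
  {f | ∃ a b : σ →₀ ℕ, IsPrimitive I a b ∧ f = binomial F a b}

end Groebner

section Graph

variable {V : Type u}

/-- The variable `x_i`. -/
def x (F : Type v) [Field F] (i : V) : MvPolynomial (V ⊕ V) F := X (Sum.inl i)

/-- The variable `y_i`. -/
def y (F : Type v) [Field F] (i : V) : MvPolynomial (V ⊕ V) F := X (Sum.inr i)

/-- The binomial edge ideal of `G`. -/
def binomialEdgeIdeal (F : Type v) [Field F] (G : SimpleGraph V) :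
    Ideal (MvPolynomial (V ⊕ V) F) :=
  Ideal.span {f | ∃ i j : V, G.Adj i j ∧ f = x F i * y F j - x F j * y F i}

/-- An `(i, j)`-path (a walk in Mathlib's terms) is weakly admissible if it has no repeated vertex
and no proper subset of its vertex set is the vertex set of an `(i, j)`-path. -/
def WeaklyAdmissible {G : SimpleGraph V} {i j : V} (p : G.Walk i j) : Prop :=
  p.support.Nodup ∧
    ∀ q : G.Walk i j, ¬ ({k | k ∈ q.support} ⊂ {k | k ∈ p.support})

/-- The nonzero binomials `t_{i_1} ⋯ t_{i_{r-1}} (x_i y_j - x_j y_i)`, where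
`i = i_0, i_1, …, i_r = j` is a weakly admissible path and each `t_k` is `x_k` or `y_k`.
The list `p.support.tail.dropLast` is `[i_1, …, i_{r-1}]` (empty for `r = 0, 1`). -/
def pathBinomials (F : Type v) [Field F] (G : SimpleGraph V) : Set (MvPolynomial (V ⊕ V) F) :=
  {f | f ≠ 0 ∧ ∃ (i j : V) (p : G.Walk i j), WeaklyAdmissible p ∧
    ∃ t : V → MvPolynomial (V ⊕ V) F, (∀ k, t k = x F k ∨ t k = y F k) ∧
      f = (p.support.tail.dropLast.map t).prod * (x F i * y F j - x F j * y F i)}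

end Graph

end BEI

end

open MvPolynomial

namespace BEI

universe u v

/-! ### Reduced Gröbner bases and Graver bases of ideals generated by pure difference binomials. -/

section Groebner

variable {σ : Type u} {F : Type v} [Field F]

/-! For any ideal generated by pure difference binomials, reduced Gröbner basis elements are
primitive binomials, so the universal basis lies in the Graver basis. It remains to identify the
latter with the path binomials and to put each path binomial into some reduced basis.

The link to the graph is an invariant (`componentSetoid`): trading `x_i y_j` for `x_j y_i` along an
edge preserves every vertex degree and the total `x`-degree on each connected component of the
support. So for a nonzero binomial in `J_G` some walk inside the support joins a vertex where the
first monomial has larger `x`-degree to one where it has smaller (`exists_walk_of_mem`).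

A shortest such walk is weakly admissible, and one of its path binomials divides the given binomial
termwise; primitivity forces equality (`IsPrimitive.exists_path`). Conversely, a binomial dividing a
path binomial yields a walk between the same ends inside the path; weak admissibility makes it visit
every vertex, leaving no room for a proper divisor (`WeaklyAdmissible.isPrimitive`).

Finally, a lexicographic order adapted to the path and to the choice of the `t_k` makes that path
binomial reduced (`pathBinomials_subset_universalGroebnerBasis`). -/

lemma coeff_binomial [DecidableEq σ] (a b c : σ →₀ ℕ) :
    (binomial F a b).coeff c = (if a = c then 1 else 0) - (if b = c then 1 else 0) := by
  simp [binomial, coeff_monomial]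

lemma eq_or_eq_of_mem_support_binomial {a b c : σ →₀ ℕ} (h : c ∈ (binomial F a b).support) :
    c = a ∨ c = b := by
  classical
  rw [mem_support_iff, coeff_binomial] at h
  by_contra! hc
  simp [hc.1.symm, hc.2.symm] at h

lemma coeff_binomial_left {a b : σ →₀ ℕ} (h : a ≠ b) : (binomial F a b).coeff a = 1 := by
  classical
  simp [coeff_binomial, h.symm]

lemma coeff_binomial_right {a b : σ →₀ ℕ} (h : a ≠ b) : (binomial F a b).coeff b = -1 := by
  classical
  simp [coeff_binomial, h]

lemma binomial_ne_zero {a b : σ →₀ ℕ} (h : a ≠ b) : binomial F a b ≠ 0 := fun h0 => by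
  have := coeff_binomial_left (F := F) h
  simp [h0] at this

lemma binomial_self (a : σ →₀ ℕ) : binomial F a a = 0 := sub_self _

lemma neg_binomial (a b : σ →₀ ℕ) : -binomial F a b = binomial F b a := neg_sub _ _

lemma binomial_add_binomial (a b c : σ →₀ ℕ) :
    binomial F a b + binomial F b c = binomial F a c := sub_add_sub_cancel _ _ _

lemma monomial_mul_binomial (c a b : σ →₀ ℕ) :
    monomial c 1 * binomial F a b = binomial F (c + a) (c + b) := by
  simp [binomial, mul_sub, monomial_mul]

/-- Sum the coefficients of a polynomial over the classes of a setoid on exponents. -/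
noncomputable def classSum (F : Type v) [Field F] (r : Setoid (σ →₀ ℕ)) :
    MvPolynomial σ F →ₗ[F] (Quotient r →₀ F) :=
  (basisMonomials σ F).constr F fun a => Finsupp.single (Quotient.mk r a) 1

lemma classSum_monomial (r : Setoid (σ →₀ ℕ)) (a : σ →₀ ℕ) (z : F) :
    classSum F r (monomial a z) = Finsupp.single (Quotient.mk r a) z := by
  have h : classSum F r (monomial a 1) = Finsupp.single (Quotient.mk r a) 1 := by
    have := (basisMonomials σ F).constr_basis F
      (fun a => Finsupp.single (Quotient.mk r a) (1 : F)) a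
    rwa [coe_basisMonomials] at this
  have hz : monomial a z = z • monomial a (1 : F) := by simp [smul_monomial]
  rw [hz, map_smul, h, Finsupp.smul_single, smul_eq_mul, mul_one]

lemma classSum_eq_zero_of_mem {r : Setoid (σ →₀ ℕ)} {S : Set (MvPolynomial σ F)}
    (hS : ∀ s ∈ S, ∃ a b, s = binomial F a b ∧ ∀ c, r (c + a) (c + b))
    {f : MvPolynomial σ F} (hf : f ∈ Ideal.span S) : classSum F r f = 0 := by
  -- `classSum` is only `F`-linear, so the induction over the span has to carry all polynomial
  -- multiples.
  suffices H : ∀ h, classSum F r (h * f) = 0 by simpa using H 1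
  induction hf using Submodule.span_induction with
  | mem s hs =>
    intro h
    obtain ⟨a, b, rfl, hr⟩ := hS s hs
    induction h using MvPolynomial.induction_on' with
    | monomial c z =>
      have hq : Quotient.mk r (c + a) = Quotient.mk r (c + b) := Quotient.sound (hr c)
      simp [binomial, mul_sub, monomial_mul, classSum_monomial, hq]
    | add p q hp hq => rw [add_mul, map_add, hp, hq, add_zero]
  | zero => simp
  | add p q _ _ hp hq => intro h; rw [mul_add, map_add, hp, hq, add_zero]
  | smul z p _ hp => intro h; rw [smul_eq_mul, ← mul_assoc, hp]

/-- In an ideal generated by binomials with equivalent exponents, no exponent of an element is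
alone in its class. -/
lemma exists_equiv_mem_support {r : Setoid (σ →₀ ℕ)} {S : Set (MvPolynomial σ F)}
    (hS : ∀ s ∈ S, ∃ a b, s = binomial F a b ∧ ∀ c, r (c + a) (c + b))
    {f : MvPolynomial σ F} (hf : f ∈ Ideal.span S) {a : σ →₀ ℕ} (ha : a ∈ f.support) :
    ∃ b ∈ f.support, b ≠ a ∧ r b a := by
  classical
  by_contra! H
  have h0 := DFunLike.congr_fun (classSum_eq_zero_of_mem hS hf) (Quotient.mk r a)
  rw [f.as_sum, map_sum, Finsupp.finsetSum_apply, Finset.sum_eq_single a] at h0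
  · simp [classSum_monomial] at h0
    simp [h0] at ha
  · intro b hb hba
    rw [classSum_monomial, Finsupp.single_apply, if_neg]
    exact fun hq => H b hb hba (Quotient.exact hq)
  · exact fun h => absurd ha h

/-- Two exponents are equivalent modulo `I` if their monomials agree modulo `I`. -/
def exponentSetoid (I : Ideal (MvPolynomial σ F)) : Setoid (σ →₀ ℕ) where
  r a b := binomial F a b ∈ I
  iseqv :=
    { refl := fun a => by simp [binomial_self]
      symm := fun {a b} h => by rw [← neg_binomial]; exact I.neg_mem h
      trans := fun {a b c} h h' => by
        rw [← binomial_add_binomial a b c]; exact I.add_mem h h' }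

/-- Ideals generated by pure difference binomials. -/
def IsBinomialIdeal (I : Ideal (MvPolynomial σ F)) : Prop :=
  ∃ S : Set (MvPolynomial σ F), (∀ s ∈ S, ∃ a b, s = binomial F a b) ∧ I = Ideal.span S

/-- Congruence modulo `I` is itself a relation compatible with the generators, so the class-sum
argument applies to it. -/
lemma IsBinomialIdeal.exists_binomial_mem {I : Ideal (MvPolynomial σ F)} (hI : IsBinomialIdeal I)
    {f : MvPolynomial σ F} (hf : f ∈ I) {a : σ →₀ ℕ} (ha : a ∈ f.support) :
    ∃ b ∈ f.support, b ≠ a ∧ binomial F a b ∈ I := by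
  obtain ⟨S, hS, rfl⟩ := hI
  obtain ⟨b, hb, hba, h⟩ := exists_equiv_mem_support (r := exponentSetoid (Ideal.span S))
    (fun s hs => by
      obtain ⟨a, b, rfl⟩ := hS s hs
      refine ⟨a, b, rfl, fun c => ?_⟩
      change binomial F (c + a) (c + b) ∈ Ideal.span S
      rw [← monomial_mul_binomial]
      exact Ideal.mul_mem_left _ _ (Ideal.subset_span hs)) hf ha
  exact ⟨b, hb, hba, (exponentSetoid (Ideal.span S)).symm h⟩

variable (m : MonomialOrder.{u, u} σ)

lemma degree_binomial {a b : σ →₀ ℕ} (h : m.toSyn b < m.toSyn a) :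
    m.degree (binomial F a b) = a := by
  have hab : a ≠ b := fun e => by simp [e] at h
  apply m.toSyn.injective
  apply le_antisymm
  · rw [m.degree_le_iff]
    intro c hc
    rcases eq_or_eq_of_mem_support_binomial hc with rfl | rfl
    exacts [le_rfl, h.le]
  · exact m.le_degree (by rw [mem_support_iff, coeff_binomial_left hab]; exact one_ne_zero)

lemma monic_binomial {a b : σ →₀ ℕ} (h : m.toSyn b < m.toSyn a) : m.Monic (binomial F a b) := by
  have hab : a ≠ b := fun e => by simp [e] at h
  rw [MonomialOrder.Monic, MonomialOrder.leadingCoeff, degree_binomial m h, coeff_binomial_left hab]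

variable {m}

lemma leadingTerm_of_monic {f : MvPolynomial σ F} (hf : m.Monic f) :
    m.leadingTerm f = monomial (m.degree f) 1 := by
  rw [MonomialOrder.leadingTerm, hf.leadingCoeff_eq_one]

lemma span_leadingTerm_of_monic {B : Set (MvPolynomial σ F)} (hB : ∀ b ∈ B, m.Monic b) :
    Ideal.span (m.leadingTerm '' B) =
      Ideal.span ((fun s => monomial s (1 : F)) '' (m.degree '' B)) := by
  rw [Set.image_image]
  congr 1
  exact Set.image_congr fun b hb => leadingTerm_of_monic (hB b hb)

lemma IsReducedGroebnerBasis.exists_degree_le {I : Ideal (MvPolynomial σ F)}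
    {B : Set (MvPolynomial σ F)} (hB : IsReducedGroebnerBasis m I B) {f : MvPolynomial σ F}
    (hf : f ∈ I) (hf0 : f ≠ 0) : ∃ b ∈ B, m.degree b ≤ m.degree f := by
  have h : m.leadingTerm f ∈ Ideal.span (m.leadingTerm '' B) := by
    rw [hB.1.2.2]
    exact Ideal.subset_span ⟨f, hf, rfl⟩
  rw [span_leadingTerm_of_monic hB.2.1, mem_ideal_span_monomial_image] at h
  obtain ⟨_, ⟨b, hb, rfl⟩, hle⟩ := h (m.degree f) (by
    rw [m.support_leadingTerm' hf0]; simp)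
  exact ⟨b, hb, hle⟩

/-- Elements of reduced Gröbner bases of binomial ideals are primitive binomials, with the leading
monomial first. -/
lemma IsReducedGroebnerBasis.exists_isPrimitive {I : Ideal (MvPolynomial σ F)}
    (hI : IsBinomialIdeal I) {B : Set (MvPolynomial σ F)} (hB : IsReducedGroebnerBasis m I B)
    {f : MvPolynomial σ F} (hf : f ∈ B) :
    ∃ a b, IsPrimitive I a b ∧ f = binomial F a b ∧ m.toSyn b < m.toSyn a := by
  have hmon := hB.2.1 f hf
  have hfI := hB.1.2.1 hf
  have hf0 : f ≠ 0 := hmon.ne_zero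
  obtain ⟨b, hb, hba, hbin⟩ := hI.exists_binomial_mem hfI (m.degree_mem_support hf0)
  have lt_of_ne : ∀ c ∈ f.support, c ≠ m.degree f → m.toSyn c < m.toSyn (m.degree f) :=
    fun c hc hne => lt_of_le_of_ne (m.le_degree hc) fun e => hne (m.toSyn.injective e)
  -- no exponent of `f` other than the leading one is divisible by a leading exponent
  have standard : ∀ c ∈ f.support, c ≠ m.degree f → ∀ g ∈ I, g ≠ 0 → ¬ m.degree g ≤ c := by
    intro c hc hne g hg hg0 hle
    obtain ⟨h, hh, hhle⟩ := hB.exists_degree_le hg hg0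
    by_cases hhf : h = f
    · subst hhf
      exact absurd (m.toSyn_monotone (hhle.trans hle)) (not_le.mpr (lt_of_ne c hc hne))
    · exact hB.2.2 f hf c hc h hh hhf (hhle.trans hle)
  have hlt := lt_of_ne b hb hba
  have hfeq : f = binomial F (m.degree f) b := by
    by_contra hne
    have hg0 : f - binomial F (m.degree f) b ≠ 0 := sub_ne_zero.mpr hne
    have hsupp := m.degree_mem_support hg0
    set g := f - binomial F (m.degree f) b with hg
    have hgf : m.degree g ≠ m.degree f := by
      intro e
      rw [e, mem_support_iff, hg, coeff_sub, coeff_binomial_left hba.symm, hmon.coeff_degree] at hsupp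
      simp at hsupp
    -- The leading terms cancel in `g` and `b` already occurs in `f`, so the leading exponent of `g`
    -- would be a non-leading exponent of `f`.
    refine standard (m.degree g) ?_ hgf g (I.sub_mem hfI hbin) hg0 le_rfl
    by_contra hnot
    have : m.degree g ∈ (binomial F (m.degree f) b).support := by
      rw [mem_support_iff] at hsupp hnot ⊢
      rw [hg, coeff_sub, ← hg, not_not.mp hnot] at hsupp
      simpa using hsupp
    rcases eq_or_eq_of_mem_support_binomial this with e | e
    · exact hgf e
    · exact hnot (e ▸ hb)
  refine ⟨m.degree f, b, ⟨hba.symm, hbin, ?_⟩, hfeq, hlt⟩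
  intro a' b' hne hmem ha' hb'
  -- If `b'` leads, it is a leading exponent dividing the tail `b`. If `a'` leads, reducedness
  -- forces it to be the leading exponent of `f`, and then `b ≠ b'` would make `b` a leading
  -- exponent.
  rcases lt_or_gt_of_ne (fun e => hne (m.toSyn.injective e)) with h | h
  · exact absurd hb' (by
      simpa [degree_binomial m h] using standard b hb hba (binomial F b' a')
        (by rw [← neg_binomial]; exact I.neg_mem hmem) (binomial_ne_zero hne.symm))
  · obtain ⟨g, hg, hgle⟩ := hB.exists_degree_le hmem (binomial_ne_zero hne)
    rw [degree_binomial m h] at hgle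
    have hgf : g = f := by
      by_contra hgf
      exact hB.2.2 f hf _ (m.degree_mem_support hf0) g hg hgf (hgle.trans ha')
    subst hgf
    obtain rfl : a' = m.degree g := le_antisymm ha' hgle
    refine ⟨rfl, ?_⟩
    by_contra hbb
    have hlt' : m.toSyn b' < m.toSyn b :=
      m.toSyn_strictMono (lt_of_le_of_ne hb' hbb)
    have hmem' : binomial F b b' ∈ I := by
      rw [← binomial_add_binomial b (m.degree g) b', ← neg_binomial]
      exact I.add_mem (I.neg_mem hbin) hmem
    exact standard b hb hba _ hmem' (binomial_ne_zero (Ne.symm hbb))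
      (by rw [degree_binomial m hlt'])

lemma universalGroebnerBasis_subset_graverBasis {I : Ideal (MvPolynomial σ F)}
    (hI : IsBinomialIdeal I) : universalGroebnerBasis I ⊆ graverBasis I := by
  rintro f ⟨m, B, hB, hf⟩
  obtain ⟨a, b, hp, he, -⟩ := hB.exists_isPrimitive hI hf
  exact ⟨a, b, hp, he⟩

variable (m) in
/-- Every binomial ideal has a reduced Gröbner basis. -/
lemma IsBinomialIdeal.exists_isReducedGroebnerBasis [Finite σ] {I : Ideal (MvPolynomial σ F)}
    (hI : IsBinomialIdeal I) : ∃ B, IsReducedGroebnerBasis m I B := by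
  -- the normal form of an exponent
  have hnf : ∀ a : σ →₀ ℕ, ∃ b, binomial F a b ∈ I ∧
      ∀ c, binomial F b c ∈ I → m.toSyn b ≤ m.toSyn c := by
    intro a
    obtain ⟨b, hb, hmin⟩ := (InvImage.wf m.toSyn (wellFounded_lt (α := m.syn))).has_min
      {b | binomial F a b ∈ I} ⟨a, by simp [binomial_self]⟩
    refine ⟨b, hb, fun c hc => not_lt.mp (hmin c ?_)⟩
    change binomial F a c ∈ I
    rw [← binomial_add_binomial a b c]
    exact I.add_mem hb hc
  choose nf hnf_mem hnf_le using hnf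
  have degree_lt : ∀ g ∈ I, g ≠ 0 → m.toSyn (nf (m.degree g)) < m.toSyn (m.degree g) := by
    intro g hg hg0
    obtain ⟨b, hb, hne, hmem⟩ := hI.exists_binomial_mem hg (m.degree_mem_support hg0)
    refine lt_of_le_of_lt (hnf_le _ b ?_)
      (lt_of_le_of_ne (m.le_degree hb) fun e => hne (m.toSyn.injective e))
    rw [← binomial_add_binomial _ (m.degree g) b, ← neg_binomial]
    exact I.add_mem (I.neg_mem (hnf_mem _)) hmem
  let D : Set (σ →₀ ℕ) := {a | ∃ g ∈ I, g ≠ 0 ∧ m.degree g = a}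
  let M : Set (σ →₀ ℕ) := {a | Minimal (· ∈ D) a}
  have hMD : ∀ a ∈ M, a ∈ D := fun a ha => ha.prop
  have hMlt : ∀ a ∈ D, m.toSyn (nf a) < m.toSyn a := by
    rintro _ ⟨g, hg, hg0, rfl⟩
    exact degree_lt g hg hg0
  have hdeg : ∀ a ∈ D, m.degree (binomial F a (nf a)) = a :=
    fun a ha => degree_binomial m (hMlt a ha)
  have hmonic : ∀ f ∈ (fun a => binomial F a (nf a)) '' M, m.Monic f := by
    rintro _ ⟨a, ha, rfl⟩
    exact monic_binomial m (hMlt a (hMD a ha))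
  have hsub : (fun a => binomial F a (nf a)) '' M ⊆ (I : Set (MvPolynomial σ F)) := by
    rintro _ ⟨a, -, rfl⟩
    exact hnf_mem a
  refine ⟨(fun a => binomial F a (nf a)) '' M, ⟨?_, hsub, ?_⟩, hmonic, ?_⟩
  -- Dickson's lemma.
  · refine Set.Finite.image _ (WellQuasiOrderedLE.finite_of_isAntichain ?_)
    exact setOfPred_minimal_antichain _
  · refine le_antisymm (Ideal.span_mono (Set.image_mono hsub)) ?_
    rw [Ideal.span_le, span_leadingTerm_of_monic hmonic]
    rintro _ ⟨g, hg, rfl⟩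
    rw [SetLike.mem_coe, mem_ideal_span_monomial_image]
    intro c hc
    by_cases hg0 : g = 0
    · simp [hg0] at hc
    rw [m.support_leadingTerm' hg0, Finset.mem_singleton] at hc
    subst hc
    obtain ⟨a, hle, ha⟩ := exists_minimal_le_of_wellFoundedLT (· ∈ D) (m.degree g) ⟨g, hg, hg0, rfl⟩
    exact ⟨a, ⟨_, ⟨a, ha, rfl⟩, hdeg a ha.prop⟩, hle⟩
  · rintro _ ⟨a, ha, rfl⟩ d hd _ ⟨a', ha', rfl⟩ hne hle
    simp only [hdeg a' (hMD a' ha')] at hle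
    rcases eq_or_eq_of_mem_support_binomial hd with rfl | rfl
    · have : a' = d := le_antisymm hle (ha.le_of_le (hMD a' ha') hle)
      exact hne (by rw [this])
    -- If `a'` divided the normal form of `a`, replacing `a'` by `nf a'` would give a smaller
    -- exponent in the same class.
    · obtain ⟨c, hc⟩ := exists_add_of_le hle
      have hmem : binomial F (nf a) (c + nf a') ∈ I := by
        rw [hc, add_comm a' c, ← monomial_mul_binomial]
        exact I.mul_mem_left _ (hnf_mem a')
      have h1 := hnf_le a _ hmem
      have h2 := hMlt a' (hMD a' ha')
      rw [hc, map_add, map_add, add_comm] at h1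
      exact absurd (le_of_add_le_add_left h1) (not_le.mpr h2)

end Groebner

/-! ### Exponent vectors of edge and path binomials. -/

section Exponents

variable {V : Type u}

/-- The exponent of `x_i y_j`. -/
noncomputable def edgeExponent (i j : V) : V ⊕ V →₀ ℕ :=
  Finsupp.single (Sum.inl i) 1 + Finsupp.single (Sum.inr j) 1

/-- The exponent of the product of the variables `s k`, for `k` in `l`. -/
noncomputable def listExponent (s : V → V ⊕ V) (l : List V) : V ⊕ V →₀ ℕ :=
  (l.map fun k => Finsupp.single (s k) 1).sum

/-- The degree of an exponent at the vertex `k`. -/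
def vertexDegree (a : V ⊕ V →₀ ℕ) (k : V) : ℕ := a (Sum.inl k) + a (Sum.inr k)

@[simp]
lemma edgeExponent_inl [DecidableEq V] (i j k : V) :
    edgeExponent i j (Sum.inl k) = if k = i then 1 else 0 := by
  simp [edgeExponent, Finsupp.single_apply, eq_comm]

@[simp]
lemma edgeExponent_inr [DecidableEq V] (i j k : V) :
    edgeExponent i j (Sum.inr k) = if k = j then 1 else 0 := by
  simp [edgeExponent, Finsupp.single_apply, eq_comm]

lemma listExponent_inl [DecidableEq V] {s : V → V ⊕ V} (hs : ∀ k, s k = .inl k ∨ s k = .inr k)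
    {l : List V} (hl : l.Nodup) (k : V) :
    listExponent s l (Sum.inl k) = if k ∈ l ∧ s k = Sum.inl k then 1 else 0 := by
  induction l with
  | nil => simp [listExponent]
  | cons v l ih =>
    rw [List.nodup_cons] at hl
    have h : listExponent s (v :: l) = Finsupp.single (s v) 1 + listExponent s l := by
      simp [listExponent]
    rw [h, Finsupp.add_apply, ih hl.2, Finsupp.single_apply]
    by_cases hk : k = v
    · subst hk; simp [hl.1]
    · have : s v ≠ Sum.inl k := by rcases hs v with e | e <;> simp [e, Ne.symm hk]
      simp [this, hk]

lemma listExponent_inr [DecidableEq V] {s : V → V ⊕ V} (hs : ∀ k, s k = .inl k ∨ s k = .inr k)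
    {l : List V} (hl : l.Nodup) (k : V) :
    listExponent s l (Sum.inr k) = if k ∈ l ∧ s k = Sum.inr k then 1 else 0 := by
  induction l with
  | nil => simp [listExponent]
  | cons v l ih =>
    rw [List.nodup_cons] at hl
    have h : listExponent s (v :: l) = Finsupp.single (s v) 1 + listExponent s l := by
      simp [listExponent]
    rw [h, Finsupp.add_apply, ih hl.2, Finsupp.single_apply]
    by_cases hk : k = v
    · subst hk; simp [hl.1]
    · have : s v ≠ Sum.inr k := by rcases hs v with e | e <;> simp [e, Ne.symm hk]
      simp [this, hk]

variable (F : Type v) [Field F]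

lemma edge_eq_binomial (i j : V) :
    x F i * y F j - x F j * y F i = binomial F (edgeExponent i j) (edgeExponent j i) := by
  simp [x, y, X, binomial, monomial_mul, edgeExponent]

lemma prod_map_X (s : V → V ⊕ V) (l : List V) :
    (l.map fun k => (X (s k) : MvPolynomial (V ⊕ V) F)).prod = monomial (listExponent s l) 1 := by
  induction l with
  | nil => simp [listExponent]
  | cons v l ih =>
    rw [List.map_cons, List.prod_cons, ih]
    simp [listExponent, X, monomial_mul]

lemma prod_mul_edge_eq_binomial (s : V → V ⊕ V) (l : List V) (i j : V) :
    (l.map fun k => (X (s k) : MvPolynomial (V ⊕ V) F)).prod * (x F i * y F j - x F j * y F i) =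
      binomial F (listExponent s l + edgeExponent i j) (listExponent s l + edgeExponent j i) := by
  rw [prod_map_X, edge_eq_binomial, monomial_mul_binomial]

end Exponents

/-! ### Inner vertices of walks, and membership of path binomials in the ideal. -/

section Walks

variable {V : Type u} {G : SimpleGraph V} {i j : V}

/-- The inner vertices of a walk. -/
def inner (p : G.Walk i j) : List V := p.support.tail.dropLast

lemma support_eq_cons_inner (p : G.Walk i j) (hij : i ≠ j) :
    p.support = i :: (inner p ++ [j]) := by
  cases p with
  | nil => exact absurd rfl hij
  | cons h q =>
    have := List.dropLast_append_getLast q.support_ne_nil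
    rw [q.getLast_support] at this
    simp [inner, this]

lemma mem_support_iff_inner (p : G.Walk i j) (hij : i ≠ j) (k : V) :
    k ∈ p.support ↔ k = i ∨ k ∈ inner p ∨ k = j := by
  rw [support_eq_cons_inner p hij]
  simp

lemma nodup_inner {p : G.Walk i j} (hp : p.support.Nodup) (hij : i ≠ j) :
    (inner p).Nodup ∧ i ∉ inner p ∧ j ∉ inner p := by
  rw [support_eq_cons_inner p hij, List.nodup_cons, List.nodup_append] at hp
  refine ⟨hp.2.1, fun h => hp.1 (by simp [h]), fun h => ?_⟩
  exact hp.2.2.2 j h j (by simp) rfl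

lemma inner_cons_of_ne {k : V} (h : G.Adj i k) (q : G.Walk k j) (hkj : k ≠ j) :
    inner (SimpleGraph.Walk.cons h q) = k :: inner q := by
  have := support_eq_cons_inner q hkj
  change q.support.dropLast = _
  rw [this, ← List.cons_append, List.dropLast_concat]

lemma vertexDegree_path [DecidableEq V] {s : V → V ⊕ V} (hs : ∀ k, s k = .inl k ∨ s k = .inr k)
    {p : G.Walk i j} (hp : p.support.Nodup) (hij : i ≠ j) (k : V) :
    vertexDegree (listExponent s (inner p) + edgeExponent i j) k =
      if k ∈ p.support then 1 else 0 := by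
  obtain ⟨hn, hi, hj⟩ := nodup_inner hp hij
  simp only [mem_support_iff_inner p hij, vertexDegree, Finsupp.add_apply, listExponent_inl hs hn, listExponent_inr hs hn,
    edgeExponent_inl, edgeExponent_inr]
  by_cases h1 : k = i
  · subst h1; simp [hi, hij]
  by_cases h2 : k = j
  · subst h2; simp [hj, h1]
  by_cases h3 : k ∈ inner p
  · rcases hs k with e | e <;> simp [h1, h2, h3, e]
  · simp [h1, h2, h3]

variable (F : Type v) [Field F]

/-- Induction on the walk through the Plücker-type identity `z_k [i,j] = z_i [k,j] + z_j [i,k]`,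
where `[i,j] = x_i y_j - x_j y_i` and `z` is either `x` or `y`. -/
lemma prod_mul_edge_mem (s : V → V ⊕ V) (hs : ∀ k, s k = .inl k ∨ s k = .inr k) (p : G.Walk i j) :
    ((inner p).map fun k => (X (s k) : MvPolynomial (V ⊕ V) F)).prod *
      (x F i * y F j - x F j * y F i) ∈ binomialEdgeIdeal F G := by
  induction p with
  | nil => simp
  | @cons i k j h q ih =>
    have hedge : x F i * y F k - x F k * y F i ∈ binomialEdgeIdeal F G :=
      Ideal.subset_span ⟨i, k, h, rfl⟩
    by_cases hkj : k = j
    · subst hkj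
      exact Ideal.mul_mem_left _ _ hedge
    rw [inner_cons_of_ne h q hkj, List.map_cons, List.prod_cons]
    set P := ((inner q).map fun k => (X (s k) : MvPolynomial (V ⊕ V) F)).prod
    rcases hs k with e | e
    · have hx : (X (s k) : MvPolynomial (V ⊕ V) F) = x F k := by rw [e, x]
      have : X (s k) * P * (x F i * y F j - x F j * y F i) =
          x F i * (P * (x F k * y F j - x F j * y F k)) +
            P * x F j * (x F i * y F k - x F k * y F i) := by rw [hx]; ring
      rw [this]
      exact Ideal.add_mem _ (Ideal.mul_mem_left _ _ ih) (Ideal.mul_mem_left _ _ hedge)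
    · have hy : (X (s k) : MvPolynomial (V ⊕ V) F) = y F k := by rw [e, y]
      have : X (s k) * P * (x F i * y F j - x F j * y F i) =
          y F i * (P * (x F k * y F j - x F j * y F k)) +
            P * y F j * (x F i * y F k - x F k * y F i) := by rw [hy]; ring
      rw [this]
      exact Ideal.add_mem _ (Ideal.mul_mem_left _ _ ih) (Ideal.mul_mem_left _ _ hedge)

lemma path_binomial_mem {s : V → V ⊕ V} (hs : ∀ k, s k = .inl k ∨ s k = .inr k)
    (p : G.Walk i j) :
    binomial F (listExponent s (inner p) + edgeExponent i j)
      (listExponent s (inner p) + edgeExponent j i) ∈ binomialEdgeIdeal F G := by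
  rw [← prod_mul_edge_eq_binomial]
  exact prod_mul_edge_mem F s hs p

end Walks

/-! ### A combinatorial invariant of congruence modulo the binomial edge ideal. -/

section Congruence

variable {V : Type u} (G : SimpleGraph V)

/-- Two exponents are equivalent if they have the same degree at every vertex and the same degree
in the `x`-variables on every set of vertices that is closed under adjacency in the support. -/
def componentSetoid : Setoid (V ⊕ V →₀ ℕ) where
  r a b := (∀ k, vertexDegree a k = vertexDegree b k) ∧ ∀ C : Finset V,
    (∀ k ∈ C, ∀ l, G.Adj k l → 0 < vertexDegree a k → 0 < vertexDegree a l → l ∈ C) →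
      ∑ k ∈ C, a (Sum.inl k) = ∑ k ∈ C, b (Sum.inl k)
  iseqv :=
    { refl := fun a => ⟨fun _ => rfl, fun _ _ => rfl⟩
      symm := fun {a b} h => ⟨fun k => (h.1 k).symm, fun C hC => (h.2 C (by simpa [h.1] using hC)).symm⟩
      trans := fun {a b c} h h' => ⟨fun k => (h.1 k).trans (h'.1 k), fun C hC =>
        (h.2 C hC).trans (h'.2 C (by simpa [h.1] using hC))⟩ }

variable {G}

/-- Both ends of the edge lie in the support, so a closed set contains both or neither, and moving
`x`-degree from one to the other does not change the sum. -/
lemma componentSetoid_edge {i j : V} (h : G.Adj i j) (c : V ⊕ V →₀ ℕ) :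
    componentSetoid G (c + edgeExponent i j) (c + edgeExponent j i) := by
  classical
  refine ⟨fun k => ?_, fun C hC => ?_⟩
  · simp only [vertexDegree, Finsupp.add_apply, edgeExponent_inl, edgeExponent_inr]
    omega
  · have hi : 0 < vertexDegree (c + edgeExponent i j) i := by simp [vertexDegree]
    have hj : 0 < vertexDegree (c + edgeExponent i j) j := by simp [vertexDegree]
    have hiff : i ∈ C ↔ j ∈ C := ⟨fun H => hC i H j h hi hj, fun H => hC j H i h.symm hj hi⟩
    simp [Finset.sum_add_distrib, hiff]

variable (F : Type v) [Field F]

lemma isBinomialIdeal_binomialEdgeIdeal : IsBinomialIdeal (binomialEdgeIdeal F G) := by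
  refine ⟨_, ?_, rfl⟩
  rintro _ ⟨i, j, -, rfl⟩
  exact ⟨_, _, edge_eq_binomial F i j⟩

variable {F}

lemma componentSetoid_of_mem {a b : V ⊕ V →₀ ℕ} (hab : a ≠ b)
    (h : binomial F a b ∈ binomialEdgeIdeal F G) : componentSetoid G a b := by
  obtain ⟨c, hc, hcb, hr⟩ := exists_equiv_mem_support (r := componentSetoid G) (a := b)
    (by
      rintro _ ⟨i, j, hij, rfl⟩
      exact ⟨_, _, edge_eq_binomial F i j, componentSetoid_edge hij⟩) h
    (by rw [mem_support_iff, coeff_binomial_right hab]; simp)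
  rcases eq_or_eq_of_mem_support_binomial hc with rfl | rfl
  exacts [hr, absurd rfl hcb]

lemma vertexDegree_eq_of_mem {a b : V ⊕ V →₀ ℕ} (hab : a ≠ b)
    (h : binomial F a b ∈ binomialEdgeIdeal F G) (k : V) : vertexDegree a k = vertexDegree b k :=
  (componentSetoid_of_mem hab h).1 k

/-- The exponents of a nonzero binomial in the ideal can be compared along a walk in their support. -/
lemma exists_walk_of_mem [Finite V] {a b : V ⊕ V →₀ ℕ} (hab : a ≠ b)
    (h : binomial F a b ∈ binomialEdgeIdeal F G) :
    ∃ (i j : V) (q : G.Walk i j), b (Sum.inl i) < a (Sum.inl i) ∧ a (Sum.inl j) < b (Sum.inl j) ∧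
      ∀ k ∈ q.support, 0 < vertexDegree a k := by
  classical
  have := Fintype.ofFinite V
  obtain ⟨hdeg, hsum⟩ := componentSetoid_of_mem hab h
  have hex : ∃ i, a (Sum.inl i) ≠ b (Sum.inl i) := by
    by_contra! H
    apply hab
    ext (k | k)
    · exact H k
    · have h1 := hdeg k
      have h2 := H k
      simp only [vertexDegree] at h1
      omega
  obtain ⟨i, hi⟩ := hex
  have hipos : 0 < vertexDegree a i := by
    have h1 := hdeg i
    simp only [vertexDegree] at h1 ⊢
    omega
  -- The component of `i` in the support of `a`; equal `x`-degree sums over it force a discrepancy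
  -- of the opposite sign at another of its vertices.
  let C : Finset V := {l | ∃ q : G.Walk i l, ∀ k ∈ q.support, 0 < vertexDegree a k}
  have hiC : i ∈ C := by
    simp only [C, Finset.mem_filter_univ]
    exact ⟨.nil, by simpa using hipos⟩
  have hC := hsum C (by
    intro k hk l hkl _ hl
    simp only [C, Finset.mem_filter_univ] at hk ⊢
    obtain ⟨q, hq⟩ := hk
    refine ⟨q.concat hkl, fun v hv => ?_⟩
    rw [SimpleGraph.Walk.support_concat, List.mem_append, List.mem_singleton] at hv
    rcases hv with hv | rfl
    exacts [hq v hv, hl])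
  rcases lt_or_gt_of_ne hi with hlt | hgt
  · have : ∃ j ∈ C, b (Sum.inl j) < a (Sum.inl j) := by
      by_contra! H
      exact absurd hC (Finset.sum_lt_sum H ⟨i, hiC, hlt⟩).ne
    obtain ⟨j, hj, hlt'⟩ := this
    simp only [C, Finset.mem_filter_univ] at hj
    obtain ⟨q, hq⟩ := hj
    exact ⟨j, i, q.reverse, hlt', hlt, by simpa using hq⟩
  · have : ∃ j ∈ C, a (Sum.inl j) < b (Sum.inl j) := by
      by_contra! H
      exact absurd hC (Finset.sum_lt_sum H ⟨i, hiC, hgt⟩).ne'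
    obtain ⟨j, hj, hlt'⟩ := this
    simp only [C, Finset.mem_filter_univ] at hj
    obtain ⟨q, hq⟩ := hj
    exact ⟨i, j, q, hgt, hlt', hq⟩

end Congruence

/-! ### Primitive binomials are exactly the path binomials. -/

section Primitive

variable {V : Type u} {G : SimpleGraph V} {F : Type v} [Field F]

lemma WeaklyAdmissible.support_subset {i j : V} {p q : G.Walk i j} (hp : WeaklyAdmissible p)
    (hq : ∀ k ∈ q.support, k ∈ p.support) : ∀ k ∈ p.support, k ∈ q.support := by
  intro k hk
  by_contra hkq
  exact hp.2 q ⟨hq, fun h => hkq (h hk)⟩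

/-- The exponents of a primitive binomial are those of a path binomial. -/
lemma IsPrimitive.exists_path [Finite V] {a b : V ⊕ V →₀ ℕ}
    (h : IsPrimitive (binomialEdgeIdeal F G) a b) :
    ∃ (i j : V) (p : G.Walk i j) (s : V → V ⊕ V), i ≠ j ∧ WeaklyAdmissible p ∧
      (∀ k, s k = .inl k ∨ s k = .inr k) ∧ a = listExponent s (inner p) + edgeExponent i j ∧
      b = listExponent s (inner p) + edgeExponent j i := by
  classical
  obtain ⟨hab, hmem, hprim⟩ := h
  have hdeg := vertexDegree_eq_of_mem hab hmem
  -- a walk of minimal length along which the exponents can be compared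
  have hex : ∃ n, ∃ (i j : V) (q : G.Walk i j), b (Sum.inl i) < a (Sum.inl i) ∧
      a (Sum.inl j) < b (Sum.inl j) ∧ (∀ k ∈ q.support, 0 < vertexDegree a k) ∧ q.length = n := by
    obtain ⟨i, j, q, h1, h2, h3⟩ := exists_walk_of_mem hab hmem
    exact ⟨_, i, j, q, h1, h2, h3, rfl⟩
  obtain ⟨i, j, p, hi, hj, hpos, hlen⟩ := Nat.find_spec hex
  have hmin : ∀ (i' j' : V) (q : G.Walk i' j'), b (Sum.inl i') < a (Sum.inl i') →
      a (Sum.inl j') < b (Sum.inl j') → (∀ k ∈ q.support, 0 < vertexDegree a k) →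
      p.length ≤ q.length := by
    intro i' j' q h1 h2 h3
    rw [hlen]
    exact Nat.find_min' hex ⟨i', j', q, h1, h2, h3, rfl⟩
  have hij : i ≠ j := by rintro rfl; omega
  have hpath : p.IsPath := by
    rw [← p.bypass_eq_self_of_length_le_length_bypass (hmin i j p.bypass hi hj fun k hk =>
      hpos k (p.support_bypass_subset_support hk))]
    exact p.bypass_isPath
  have hwa : WeaklyAdmissible p := by
    refine ⟨hpath.support_nodup, fun q hq => ?_⟩
    have hqp : ∀ k ∈ q.bypass.support, k ∈ p.support :=
      fun k hk => hq.1 (q.support_bypass_subset_support hk)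
    have hle := hmin i j q.bypass hi hj fun k hk => hpos k (hqp k hk)
    obtain ⟨k, hkp, hkq⟩ := Set.exists_of_ssubset hq
    -- On paths, fewer vertices means smaller length, against minimality of `p`.
    have hlt : q.bypass.support.toFinset.card < p.support.toFinset.card := by
      refine Finset.card_lt_card ⟨fun k hk => ?_, fun hsub => hkq ?_⟩
      · simpa using hqp k (by simpa using hk)
      · exact q.support_bypass_subset_support
          (by simpa using hsub (List.mem_toFinset.mpr hkp))
    rw [List.toFinset_card_of_nodup q.bypass_isPath.support_nodup,
      List.toFinset_card_of_nodup hpath.support_nodup, SimpleGraph.Walk.length_support,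
      SimpleGraph.Walk.length_support] at hlt
    omega
  -- A discrepancy at an inner vertex would allow the walk to be cut there to a shorter one.
  have hmid : ∀ k ∈ inner p, a (Sum.inl k) = b (Sum.inl k) := by
    intro k hk
    obtain ⟨-, hin, hjn⟩ := nodup_inner hpath.support_nodup hij
    have hki : k ≠ i := fun e => hin (e ▸ hk)
    have hkj : k ≠ j := fun e => hjn (e ▸ hk)
    have hks : k ∈ p.support := by rw [mem_support_iff_inner p hij]; simp [hk]
    by_contra hne
    rcases lt_or_gt_of_ne hne with hlt | hgt
    · have := hmin i k (p.takeUntil k hks) hi hlt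
        fun v hv => hpos v (p.support_takeUntil_subset_support hks hv)
      have := SimpleGraph.Walk.length_takeUntil_lt_length hks hkj
      omega
    · have := hmin k j (p.dropUntil k hks) hgt hj
        fun v hv => hpos v (p.support_dropUntil_subset_support hks hv)
      have := SimpleGraph.Walk.length_dropUntil_lt_length hks hki
      omega
  -- At inner vertices `a` and `b` agree and have positive degree, so the variable chosen here
  -- divides both monomials.
  let s : V → V ⊕ V := fun k => if 0 < a (Sum.inl k) then Sum.inl k else Sum.inr k
  have hs : ∀ k, s k = .inl k ∨ s k = .inr k := fun k => by
    by_cases h0 : 0 < a (Sum.inl k) <;> simp [s, h0]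
  obtain ⟨hn, hin, hjn⟩ := nodup_inner hpath.support_nodup hij
  have hle : ∀ k, listExponent s (inner p) (Sum.inl k) ≤ a (Sum.inl k) ∧
      listExponent s (inner p) (Sum.inl k) ≤ b (Sum.inl k) ∧
      listExponent s (inner p) (Sum.inr k) ≤ a (Sum.inr k) ∧
      listExponent s (inner p) (Sum.inr k) ≤ b (Sum.inr k) := by
    intro k
    rw [listExponent_inl hs hn, listExponent_inr hs hn]
    by_cases hk : k ∈ inner p
    · have h1 := hmid k hk
      have h2 := hdeg k
      have h3 := hpos k (by rw [mem_support_iff_inner p hij]; simp [hk])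
      simp only [vertexDegree] at h2 h3
      by_cases h0 : 0 < a (Sum.inl k)
      · simp [s, h0, hk]; omega
      · simp [s, h0, hk]; omega
    · simp [hk]
  have hdi := hdeg i
  have hdj := hdeg j
  simp only [vertexDegree] at hdi hdj
  have hzero : ∀ k ∉ inner p, listExponent s (inner p) (Sum.inl k) = 0 ∧
      listExponent s (inner p) (Sum.inr k) = 0 := by
    intro k hk
    rw [listExponent_inl hs hn, listExponent_inr hs hn]
    simp [hk]
  have hzi := hzero i hin
  have hzj := hzero j hjn
  have hne : listExponent s (inner p) + edgeExponent i j ≠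
      listExponent s (inner p) + edgeExponent j i := by
    intro e
    have := DFunLike.congr_fun (add_left_cancel e) (Sum.inl i)
    simp [hij] at this
  obtain ⟨ha, hb⟩ := hprim _ _ hne (path_binomial_mem F hs p)
    (by
      rintro (k | k)
      · rw [Finsupp.add_apply, edgeExponent_inl]
        have := hle k
        split_ifs with e
        · subst e; omega
        · omega
      · rw [Finsupp.add_apply, edgeExponent_inr]
        have := hle k
        split_ifs with e
        · subst e; omega
        · omega)
    (by
      rintro (k | k)
      · rw [Finsupp.add_apply, edgeExponent_inl]
        have := hle k
        split_ifs with e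
        · subst e; omega
        · omega
      · rw [Finsupp.add_apply, edgeExponent_inr]
        have := hle k
        split_ifs with e
        · subst e; omega
        · omega)
  exact ⟨i, j, p, s, hij, hwa, hs, ha.symm, hb.symm⟩

/-- Weakly admissible paths give primitive binomials. -/
lemma WeaklyAdmissible.isPrimitive [Finite V] {i j : V} {p : G.Walk i j} (hp : WeaklyAdmissible p)
    (hij : i ≠ j) {s : V → V ⊕ V} (hs : ∀ k, s k = .inl k ∨ s k = .inr k) :
    IsPrimitive (binomialEdgeIdeal F G) (listExponent s (inner p) + edgeExponent i j)
      (listExponent s (inner p) + edgeExponent j i) := by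
  classical
  obtain ⟨hn, hin, hjn⟩ := nodup_inner hp.1 hij
  refine ⟨fun e => ?_, path_binomial_mem F hs p, fun a' b' hne hmem ha hb => ?_⟩
  · have := DFunLike.congr_fun (add_left_cancel e) (Sum.inl i)
    simp [hij] at this
  have hdeg := vertexDegree_eq_of_mem hne hmem
  have hdegp := vertexDegree_path hs hp.1 hij
  have key : ∀ k, a' (Sum.inl k) ≤ listExponent s (inner p) (Sum.inl k) + (if k = i then 1 else 0) ∧
      a' (Sum.inr k) ≤ listExponent s (inner p) (Sum.inr k) + (if k = j then 1 else 0) ∧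
      b' (Sum.inl k) ≤ listExponent s (inner p) (Sum.inl k) + (if k = j then 1 else 0) ∧
      b' (Sum.inr k) ≤ listExponent s (inner p) (Sum.inr k) + (if k = i then 1 else 0) := by
    intro k
    have h1 := ha (Sum.inl k)
    have h2 := ha (Sum.inr k)
    have h3 := hb (Sum.inl k)
    have h4 := hb (Sum.inr k)
    simp only [Finsupp.add_apply, edgeExponent_inl, edgeExponent_inr] at h1 h2 h3 h4
    exact ⟨h1, h2, h3, h4⟩
  -- Away from the ends only one of the two variables at `k` can occur, so the common vertex degree
  -- determines its exponent.
  have heq : ∀ k, k ≠ i → k ≠ j → a' (Sum.inl k) = b' (Sum.inl k) := by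
    intro k hki hkj
    have h1 := key k
    have h2 := hdeg k
    simp only [vertexDegree] at h2
    rw [listExponent_inl hs hn, listExponent_inr hs hn] at h1
    rcases hs k with e | e <;> simp only [e, hki, hkj] at h1 <;> simp at h1 <;> omega
  have hzi := key i
  have hzj := key j
  simp only [listExponent_inl hs hn, listExponent_inr hs hn, hin, hjn, hij, hij.symm] at hzi hzj
  simp at hzi hzj
  obtain ⟨i', j', q, h1, h2, h3⟩ := exists_walk_of_mem hne hmem
  obtain rfl : i' = i := by
    by_contra hne'
    by_cases e : i' = j
    · subst e; omega
    · have := heq i' hne' e; omega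
  obtain rfl : j' = j := by
    by_contra hne'
    by_cases e : j' = i'
    · subst e; omega
    · have := heq j' e hne'; omega
  have hdeg_le : ∀ k, vertexDegree a' k ≤ if k ∈ p.support then 1 else 0 := by
    intro k
    rw [← hdegp k]
    exact add_le_add (ha _) (ha _)
  have hqp : ∀ k ∈ q.support, k ∈ p.support := by
    intro k hk
    by_contra hkp
    have := hdeg_le k
    have := h3 k hk
    simp only [hkp] at *
    simp at *
    omega
  have hpq := hp.support_subset hqp
  -- The divisor already has full degree at every vertex of the path, so divisibility becomes
  -- equality.
  have hfull : ∀ k, vertexDegree (listExponent s (inner p) + edgeExponent i' j') k ≤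
      vertexDegree a' k := by
    intro k
    rw [hdegp k]
    split_ifs with hk
    · exact h3 k (hpq k hk)
    · exact Nat.zero_le _
  have hdegb : ∀ k, vertexDegree (listExponent s (inner p) + edgeExponent j' i') k =
      vertexDegree (listExponent s (inner p) + edgeExponent i' j') k := by
    intro k
    simp only [vertexDegree, Finsupp.add_apply, edgeExponent_inl, edgeExponent_inr]
    omega
  constructor
  · ext (k | k) <;> have e1 := hfull k <;> have e2 := ha (Sum.inl k) <;>
      have e3 := ha (Sum.inr k) <;> simp only [vertexDegree] at e1 <;> omega
  · ext (k | k) <;> have e1 := hfull k <;> have e2 := hb (Sum.inl k) <;>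
      have e3 := hb (Sum.inr k) <;> have e4 := hdeg k <;> have e5 := hdegb k <;>
      simp only [vertexDegree] at e1 e4 e5 <;> omega

lemma mem_pathBinomials_iff {f : MvPolynomial (V ⊕ V) F} :
    f ∈ pathBinomials F G ↔ ∃ (i j : V) (p : G.Walk i j) (s : V → V ⊕ V), i ≠ j ∧
      WeaklyAdmissible p ∧ (∀ k, s k = .inl k ∨ s k = .inr k) ∧
      f = binomial F (listExponent s (inner p) + edgeExponent i j)
        (listExponent s (inner p) + edgeExponent j i) := by
  classical
  constructor
  · rintro ⟨hf, i, j, p, hp, t, ht, rfl⟩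
    have hts : ∀ k, ∃ v : V ⊕ V, (v = .inl k ∨ v = .inr k) ∧ t k = X v := fun k => by
      rcases ht k with e | e
      exacts [⟨_, .inl rfl, e⟩, ⟨_, .inr rfl, e⟩]
    choose s hs hts using hts
    refine ⟨i, j, p, s, ?_, hp, hs, ?_⟩
    · rintro rfl
      simp at hf
    · rw [← prod_mul_edge_eq_binomial, funext hts]
      rfl
  · rintro ⟨i, j, p, s, hij, hp, hs, rfl⟩
    refine ⟨binomial_ne_zero fun e => ?_, i, j, p, hp, fun k => X (s k), fun k => ?_, ?_⟩
    · have := DFunLike.congr_fun (add_left_cancel e) (Sum.inl i)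
      simp [hij] at this
    · rcases hs k with e | e <;> simp [e, x, y]
    · rw [← prod_mul_edge_eq_binomial]
      rfl

theorem pathBinomials_eq_graverBasis [Finite V] :
    pathBinomials F G = graverBasis (binomialEdgeIdeal F G) := by
  ext f
  rw [mem_pathBinomials_iff]
  constructor
  · rintro ⟨i, j, p, s, hij, hp, hs, rfl⟩
    exact ⟨_, _, hp.isPrimitive hij hs, rfl⟩
  · rintro ⟨a, b, h, rfl⟩
    obtain ⟨i, j, p, s, hij, hp, hs, rfl, rfl⟩ := h.exists_path
    exact ⟨i, j, p, s, hij, hp, hs, rfl⟩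

end Primitive

/-! ### A monomial order for each path binomial. -/

section Order

/-- Refine a weight on the variables to a lexicographic order. -/
lemma exists_monomialOrder {σ : Type u} [Finite σ] (w : σ → ℕ) :
    ∃ m : MonomialOrder.{u, u} σ, ∀ (a b : σ →₀ ℕ) (v : σ),
      (∀ v', v' ≠ v → w v ≤ w v' → a v' = b v') → a v < b v → m.toSyn a < m.toSyn b := by
  obtain ⟨N, ⟨e⟩⟩ := Finite.exists_equiv_fin σ
  -- `MonomialOrder.lex` compares smaller variables first, hence the dual: heavier variables must
  -- come first. The `Fin N` component only breaks ties.
  let key : σ → ℕᵒᵈ ×ₗ Fin N := fun v => toLex (OrderDual.toDual (w v), e v)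
  have hkey : Function.Injective key := fun v v' h => by
    simp only [key, EmbeddingLike.apply_eq_iff_eq, Prod.mk.injEq] at h
    exact h.2
  let : LinearOrder σ := LinearOrder.lift' key hkey
  refine ⟨MonomialOrder.lex, fun a b v h hv => ?_⟩
  rw [MonomialOrder.lex_lt_iff, Finsupp.Lex.lt_iff]
  refine ⟨v, fun v' hv' => h v' hv'.ne ?_, hv⟩
  have hlt : key v' < key v := hv'
  rw [Prod.Lex.lt_iff] at hlt
  rcases hlt with hlt | hlt
  · exact (OrderDual.toDual_lt_toDual.mp hlt).le
  · exact (OrderDual.toDual.injective hlt.1).ge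

variable {V : Type u} {G : SimpleGraph V} {F : Type v} [Field F]

theorem pathBinomials_subset_universalGroebnerBasis [Finite V] :
    pathBinomials F G ⊆ universalGroebnerBasis (binomialEdgeIdeal F G) := by
  classical
  intro f hf
  obtain ⟨i, j, p, s, hij, hp, hs, rfl⟩ := mem_pathBinomials_iff.mp hf
  obtain ⟨hn, hin, hjn⟩ := nodup_inner hp.1 hij
  -- `x_k y_l` can lead `x_k y_l - x_l y_k` only if `w l ≤ w k`. If `x_k` divides the leading
  -- monomial of the path binomial, `w k` is 2 (`k = i`) or 0 (`t_k = x_k`); if `y_l` does, `w l` is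
  -- 1 (`l = j`) or 3 (`t_l = y_l`). Only `(i, j)` is compatible.
  let w : V → ℕ := fun k =>
    if k ∈ inner p then (if s k = Sum.inl k then 0 else 3) else if k = j then 1 else 2
  -- The shift by 1 puts every `x` above every `y`, even where `w` vanishes.
  obtain ⟨m, hm⟩ := exists_monomialOrder (Sum.elim (fun k => w k + 1) fun _ : V => 0)
  have hlt : ∀ (c : V ⊕ V →₀ ℕ) (k l : V), w k < w l →
      m.toSyn (c + edgeExponent k l) < m.toSyn (c + edgeExponent l k) := by
    intro c k l hkl
    have hne : l ≠ k := by rintro rfl; omega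
    refine hm _ _ (Sum.inl l) ?_ (by simp [hne])
    rintro (v | v) hv hle
    · simp only [Sum.elim_inl] at hle
      have h1 : v ≠ k := by rintro rfl; omega
      have h2 : v ≠ l := fun e => hv (by rw [e])
      simp [h1, h2]
    · simp at hle
  obtain ⟨B, hB⟩ := (isBinomialIdeal_binomialEdgeIdeal (G := G) F).exists_isReducedGroebnerBasis m
  have hji : w j < w i := by simp [w, hin, hjn, hij]
  have hmem := path_binomial_mem F hs p
  obtain ⟨g, hg, hle⟩ := hB.exists_degree_le hmem hf.1
  rw [degree_binomial m (hlt _ j i hji)] at hle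
  obtain ⟨a, b, hprim, rfl, hba⟩ :=
    hB.exists_isPrimitive (isBinomialIdeal_binomialEdgeIdeal F) hg
  rw [degree_binomial m hba] at hle
  obtain ⟨k, l, q, s', hkl, hq, hs', rfl, rfl⟩ := hprim.exists_path
  have hwlk : w l ≤ w k := not_lt.mp fun h => lt_asymm hba (hlt _ k l h)
  have hk := hle (Sum.inl k)
  have hl := hle (Sum.inr l)
  simp only [Finsupp.add_apply, edgeExponent_inl, edgeExponent_inr, listExponent_inl hs hn,
    listExponent_inr hs hn, if_true] at hk hl
  have hk' : (k ∈ inner p ∧ s k = Sum.inl k) ∨ k = i := by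
    by_contra! H
    rw [if_neg (fun h => H.1 h.1 h.2), if_neg H.2] at hk
    omega
  have hl' : (l ∈ inner p ∧ s l = Sum.inr l) ∨ l = j := by
    by_contra! H
    rw [if_neg (fun h => H.1 h.1 h.2), if_neg H.2] at hl
    omega
  have hends : k = i ∧ l = j := by
    rcases hk' with ⟨hk1, hk2⟩ | rfl <;> rcases hl' with ⟨hl1, hl2⟩ | rfl
    · simp [w, hk1, hk2, hl1, hl2] at hwlk
    · simp [w, hk1, hk2, hjn] at hwlk
    · simp [w, hl1, hl2, hin, hij] at hwlk
    · exact ⟨rfl, rfl⟩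
  obtain ⟨rfl, rfl⟩ := hends
  have hdp := vertexDegree_path hs hp.1 hij
  have hdq := vertexDegree_path hs' hq.1 hij
  -- The leading monomial of the basis element has degree 1 along `q` and divides one supported on
  -- `p`; weak admissibility of `p` then gives equal vertex sets and equal monomials.
  have hqp : ∀ v ∈ q.support, v ∈ p.support := by
    intro v hv
    by_contra hvp
    have h1 := hdp v
    have h2 := hdq v
    rw [if_neg hvp] at h1
    rw [if_pos hv] at h2
    have h3 := hle (Sum.inl v)
    have h4 := hle (Sum.inr v)
    simp only [vertexDegree] at h1 h2
    omega
  have hpq := hp.support_subset hqp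
  have hdeg : ∀ v, vertexDegree (listExponent s' (inner q) + edgeExponent k l) v =
      vertexDegree (listExponent s (inner p) + edgeExponent k l) v := by
    intro v
    rw [hdp, hdq]
    exact if_congr ⟨hqp v, hpq v⟩ rfl rfl
  have heq : listExponent s' (inner q) + edgeExponent k l =
      listExponent s (inner p) + edgeExponent k l := by
    ext (v | v) <;> have h1 := hdeg v <;> have h2 := hle (Sum.inl v) <;>
      have h3 := hle (Sum.inr v) <;> simp only [vertexDegree] at h1 <;> omega
  rw [add_right_cancel heq] at hg
  exact ⟨m, B, hB, hg⟩

end Order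

end BEI

theorem mainTheorem1 {F : Type*} [Field F] {n : ℕ} (G : SimpleGraph (Fin n))
    (hG : G.Connected) :
    BEI.pathBinomials F G = BEI.universalGroebnerBasis (BEI.binomialEdgeIdeal F G) ∧
      BEI.universalGroebnerBasis (BEI.binomialEdgeIdeal F G) =
        BEI.graverBasis (BEI.binomialEdgeIdeal F G) := by
  have hsub := BEI.universalGroebnerBasis_subset_graverBasis
    (BEI.isBinomialIdeal_binomialEdgeIdeal (G := G) F)
  have hsup := BEI.pathBinomials_subset_universalGroebnerBasis (G := G) (F := F)
  have heq := BEI.pathBinomials_eq_graverBasis (G := G) (F := F)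
  exact ⟨hsup.antisymm (heq ▸ hsub), hsub.antisymm (heq ▸ hsup)⟩
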